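/- Let $d \ge 2$ and $k \ge d+1$ be integers, and let $K \subseteq \mathbb{R}^d$ be a convex body (a compact convex set with nonempty interior) with $d$-dimensional Lebesgue measure $1$. For a finite set $S \subseteq \mathbb{R}^d$, a $k$-island in $S$ is a set $I \subseteq S$ of exactly $k$ points with $\operatorname{conv}(I) \cap S = I$. If $S$ is a set of $n \ge k$ points chosen independently and uniformly at random from $K$, then the expected number of $k$-islands in $S$ is at most \[ 2^{d-1}\cdot \left(2d^{2d-1}\binom{k}{\lfloor d/2 \rfloor}\right)^{k-d-1} \cdot (k-d) \cdot \frac{n(n-1)\cdots(n-k+2)}{(n-k+1)^{k-d-1}}. \] For fixed $d$ and $k$ this bound is in $O(n^d)$ as $n\to\infty$; in particular, there is a constant $C$ depending only on $d$ and $k$ such that the expected number of $k$-islands in $S$ is at most $C n^d$ for all such $K$ and all $n \ge k$. -/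

import Mathlib

open MeasureTheory ProbabilityTheory Filter Asymptotics

/-- A convex body in `ℝ^d`: a compact convex set with nonempty interior. -/
def IsConvexBody {d : ℕ} (K : Set (EuclideanSpace ℝ (Fin d))) : Prop :=
  IsCompact K ∧ Convex ℝ K ∧ (interior K).Nonempty

/-- `I` is a `k`-island in the point set `S`: a set of `k` points of `S` with
`conv(I) ∩ S = I`. -/
def IsIsland {d : ℕ} (k : ℕ) (S I : Set (EuclideanSpace ℝ (Fin d))) : Prop :=
  I ⊆ S ∧ I.Finite ∧ I.ncard = k ∧ convexHull ℝ I ∩ S = I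

/-- The number of `k`-islands in the (finite) point set `S`. -/
noncomputable def numIslands {d : ℕ} (k : ℕ) (S : Set (EuclideanSpace ℝ (Fin d))) : ℕ :=
  {I : Set (EuclideanSpace ℝ (Fin d)) | IsIsland k S I}.ncard

/-- `X 0, …, X (n-1)` are points chosen independently and uniformly at random from `K`. -/
def IsUniformSample {d n : ℕ} (K : Set (EuclideanSpace ℝ (Fin d)))
    {Ω : Type*} [MeasurableSpace Ω] (P : Measure Ω)
    (X : Fin n → Ω → EuclideanSpace ℝ (Fin d)) : Prop :=
  (∀ i, pdf.IsUniform (X i) K P volume) ∧ iIndepFun X P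

/-- The quantity
`2^(d-1) (2 d^(2d-1) C(k,⌊d/2⌋))^(k-d-1) (k-d) · n(n-1)⋯(n-k+2) / (n-k+1)^(k-d-1)`,
used for `2 ≤ d`, `d + 1 ≤ k`, `k ≤ n`. The falling factorial has `k - 1` factors. -/
noncomputable def islandBound (d k n : ℕ) : ℝ :=
  2 ^ (d - 1) * (2 * (d : ℝ) ^ (2 * d - 1) * (k.choose (d / 2) : ℝ)) ^ (k - d - 1)
    * ((k : ℝ) - d)
    * ((n.descFactorial (k - 1) : ℝ) / ((n : ℝ) - k + 1) ^ (k - d - 1))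

/-! By linearity the expectation is C(n,k) times the probability that k fixed sample points form an
island. The other n-k points must miss their hull, so this probability is E[(1-V)^(n-k)], with V the
volume of the hull (`measure_islandEvent`). The theorem thus reduces to showing that V is rarely
small: P(V ≤ t) ≤ (k!/d!) (2^(d-1) d! t)^(k-d) (`measure_convexHull_le`). The layer-cake formula and
a beta integral convert this tail into a bound on E[(1-V)^(n-k)] (`lintegral_one_sub_pow_le`); after
multiplication by C(n,k) it is a constant times n(n-1)⋯(n-d+1), which is below `islandBound`.

For the tail, V ≤ t forces |det| ≤ s = d! t for every simplex on the points. Label the points so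
that the first d+1 span a largest simplex and, among such labellings, the first d points b span with
the origin a largest simplex, of determinant D. Given b, the next point has coordinates relative to
(b, 0) at most 1 in modulus on b and at most s/|D| on the origin; such points fill volume at most
2^(d-1) s, as D cancels (`measure_isApex_le`). By maximality each of the remaining k-d-1 points is
also confined to volume 2^(d-1) s (`measure_isCanonical_le`). There are k! labellings, and each
configuration admits at least d! good ones, whence the factor k!/d!. -/

/-! ### Simplex determinants and barycentric coordinates -/

/-- The determinant of the homogeneous coordinates of `d + 1` points of `ℝ^d`; up to sign, `d!`
times the volume of the simplex that they span. -/
noncomputable def simplexDet {d : ℕ} (f : Fin (d + 1) → EuclideanSpace ℝ (Fin d)) : ℝ :=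
  (Matrix.of fun i => (Fin.cons 1 (f i).ofLp : Fin (d + 1) → ℝ)).det

theorem simplexDet_eq_det_sub {d : ℕ} (f : Fin (d + 1) → EuclideanSpace ℝ (Fin d)) :
    simplexDet f = (Matrix.of fun i j : Fin d => f i.succ j - f 0 j).det := by
  have h := Matrix.det_eq_of_forall_row_eq_smul_add_const
    (A := Matrix.of fun i => (Fin.cons 1 (f i).ofLp : Fin (d + 1) → ℝ))
    (B := Matrix.of (Fin.cons (Fin.cons 1 (f 0).ofLp)
      (fun i => Fin.cons 0 (fun j => f i.succ j - f 0 j)) : Fin (d + 1) → Fin (d + 1) → ℝ))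
    (Fin.cons 0 fun _ => 1) 0 (by simp) (by
      intro i j
      refine Fin.cases ?_ (fun i => ?_) i <;> refine Fin.cases ?_ (fun j => ?_) j <;> simp)
  rw [simplexDet, h, Matrix.det_succ_column_zero, Fin.sum_univ_succ]
  simp
  congr 1

theorem abs_simplexDet_comp_perm {d : ℕ} (f : Fin (d + 1) → EuclideanSpace ℝ (Fin d))
    (σ : Equiv.Perm (Fin (d + 1))) : |simplexDet (f ∘ σ)| = |simplexDet f| := by
  have h := Matrix.det_permute σ
    (Matrix.of fun i => (Fin.cons 1 (f i).ofLp : Fin (d + 1) → ℝ))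
  have h2 : simplexDet (f ∘ σ) = _ := h
  rw [h2, abs_mul, ← Int.cast_abs]
  rcases Int.units_eq_one_or (Equiv.Perm.sign σ) with h | h <;> simp [h, simplexDet]

/-- Cramer's rule: barycentric coordinates are ratios of simplex determinants, so bounds on
determinants become bounds on coordinates. -/
theorem exists_barycentric {d : ℕ} {f : Fin (d + 1) → EuclideanSpace ℝ (Fin d)}
    (hf : simplexDet f ≠ 0) (y : EuclideanSpace ℝ (Fin d)) :
    ∃ c : Fin (d + 1) → ℝ, ∑ i, c i = 1 ∧ y = ∑ i, c i • f i ∧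
      ∀ i, simplexDet (Function.update f i y) = c i * simplexDet f := by
  set M : Matrix (Fin (d + 1)) (Fin (d + 1)) ℝ :=
    Matrix.of fun i => (Fin.cons 1 (f i).ofLp : Fin (d + 1) → ℝ) with hM
  have hu : IsUnit M.det := isUnit_iff_ne_zero.2 hf
  set v : Fin (d + 1) → ℝ := Fin.cons 1 y.ofLp with hv
  set c := Matrix.vecMul v M⁻¹ with hc
  have hcM : ∑ k, c k • M k = v := by
    have : Matrix.vecMul c M = v := by
      rw [hc, Matrix.vecMul_vecMul, Matrix.nonsing_inv_mul _ hu, Matrix.vecMul_one]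
    rw [← this, Matrix.vecMul_eq_sum]
  refine ⟨c, ?_, ?_, fun i => ?_⟩
  · have := congrFun hcM 0
    simpa [hM, hv] using this
  · ext j
    have := congrFun hcM j.succ
    simpa [hM, hv] using this.symm
  · have h := Matrix.det_updateRow_sum M i c
    rw [hcM, smul_eq_mul] at h
    rw [show simplexDet f = M.det from rfl, ← h, simplexDet]
    congr 1
    ext a b
    by_cases hab : a = i
    · subst hab; simp [hv]
    · simp [hab, hM]

theorem continuous_simplexDet {d : ℕ} :
    Continuous (simplexDet : (Fin (d + 1) → EuclideanSpace ℝ (Fin d)) → ℝ) := by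
  unfold simplexDet
  refine Continuous.matrix_det ?_
  refine continuous_pi fun i => continuous_pi fun j => ?_
  refine Fin.cases ?_ (fun j => ?_) j
  · simpa using continuous_const
  · simp only [Matrix.of_apply, Fin.cons_succ]
    fun_prop

/-! ### Volumes of regions in barycentric coordinates -/

/-- The affine parametrization of `ℝ^d` by barycentric coordinates with respect to `f`. -/
noncomputable def simplexParam {d : ℕ} (f : Fin (d + 1) → EuclideanSpace ℝ (Fin d))
    (c : Fin d → ℝ) : EuclideanSpace ℝ (Fin d) :=
  f 0 + ∑ i, c i • (f i.succ - f 0)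

theorem volume_image_simplexParam {d : ℕ} (f : Fin (d + 1) → EuclideanSpace ℝ (Fin d))
    (A : Set (Fin d → ℝ)) :
    volume (simplexParam f '' A) = ENNReal.ofReal |simplexDet f| * volume A := by
  set N : Matrix (Fin d) (Fin d) ℝ := Matrix.of fun i j : Fin d => f i.succ j - f 0 j with hN
  have h1 : simplexParam f '' A =
      MeasurableEquiv.toLp 2 (Fin d → ℝ) '' ((fun y => (f 0).ofLp + y) ''
        (Matrix.toLin' N.transpose '' A)) := by
    rw [Set.image_image, Set.image_image]
    refine Set.image_congr fun c _ => ?_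
    ext j
    simp [simplexParam, Matrix.mulVec, dotProduct, hN, mul_comm]
  have h2 := (PiLp.volume_preserving_toLp (Fin d)).measure_preimage_emb
    (MeasurableEquiv.toLp 2 (Fin d → ℝ)).measurableEmbedding (simplexParam f '' A)
  rw [← h2, h1]
  rw [show (WithLp.toLp 2 : (Fin d → ℝ) → _) = MeasurableEquiv.toLp 2 (Fin d → ℝ) from rfl,
    Set.preimage_image_eq _ (MeasurableEquiv.toLp 2 (Fin d → ℝ)).injective, Set.image_add_left,
    measure_preimage_add, Measure.addHaar_image_linearMap, LinearMap.det_toLin',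
    Matrix.det_transpose, simplexDet_eq_det_sub]

/-- The half-box and its reflection through 0 both lie in the full box and overlap only in the null
hyperplane ∑ c_i = 0. -/
theorem two_mul_volume_half_box_le {m : ℕ} (w : Fin (m + 1) → ℝ) :
    2 * volume {c : Fin (m + 1) → ℝ | (∀ i, |c i| ≤ w i) ∧ 0 ≤ ∑ i, c i} ≤
      ENNReal.ofReal (∏ i, 2 * w i) := by
  by_cases hw : ∀ i, 0 ≤ w i
  swap
  · push Not at hw
    obtain ⟨i, hi⟩ := hw
    have : {c : Fin (m + 1) → ℝ | (∀ i, |c i| ≤ w i) ∧ 0 ≤ ∑ i, c i} = ∅ := by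
      ext c
      simp only [Set.mem_ofPred_eq, Set.mem_empty_iff_false, iff_false]
      rintro ⟨h, -⟩
      linarith [h i, abs_nonneg (c i)]
    simp [this]
  set H := {c : Fin (m + 1) → ℝ | (∀ i, |c i| ≤ w i) ∧ 0 ≤ ∑ i, c i} with hH
  have hHm : MeasurableSet H := by
    have : IsClosed H := by
      refine IsClosed.and ?_ ?_
      · simp only [Set.ofPred_forall]
        exact isClosed_iInter fun i => isClosed_le (by fun_prop) (by fun_prop)
      · exact isClosed_le (by fun_prop) (by fun_prop)
    exact this.measurableSet
  let φ : (Fin (m + 1) → ℝ) →ₗ[ℝ] ℝ := ∑ i, LinearMap.proj i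
  have hφ : ∀ c, φ c = ∑ i, c i := fun c => by simp [φ]
  have hnull : volume (LinearMap.ker φ : Set (Fin (m + 1) → ℝ)) = 0 := by
    refine Measure.addHaar_submodule _ _ fun h => ?_
    have : (Pi.single 0 1 : Fin (m + 1) → ℝ) ∈ LinearMap.ker φ := h ▸ Submodule.mem_top
    rw [LinearMap.mem_ker, hφ] at this
    simp at this
  have hdis : AEDisjoint volume H (-H) := by
    refine measure_mono_null ?_ hnull
    rintro c ⟨⟨-, h1⟩, ⟨-, h2⟩⟩
    simp only [SetLike.mem_coe, LinearMap.mem_ker, hφ]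
    simp only [Pi.neg_apply, Finset.sum_neg_distrib] at h2
    linarith
  have hsub : H ∪ -H ⊆ Set.pi Set.univ fun i => Set.Icc (-w i) (w i) := by
    rintro c (⟨h, -⟩ | ⟨h, -⟩) i -
    · exact abs_le.1 (h i)
    · have := h i
      rw [Pi.neg_apply, abs_neg] at this
      exact abs_le.1 this
  calc 2 * volume H = volume H + volume (-H) := by rw [Measure.measure_neg, two_mul]
    _ = volume (H ∪ -H) := (measure_union₀ hHm.neg.nullMeasurableSet hdis).symm
    _ ≤ volume (Set.pi Set.univ fun i => Set.Icc (-w i) (w i)) := measure_mono hsub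
    _ = ENNReal.ofReal (∏ i, 2 * w i) := by
      rw [volume_pi_pi, ENNReal.ofReal_prod_of_nonneg fun i _ => by have := hw i; positivity]
      refine Finset.prod_congr rfl fun i _ => ?_
      rw [Real.volume_Icc]; congr 1; ring

theorem volume_half_box_le {d : ℕ} (hd : 1 ≤ d) (w : Fin d → ℝ) (hw : ∀ i, 0 ≤ w i) :
    volume {c : Fin d → ℝ | (∀ i, |c i| ≤ w i) ∧ 0 ≤ ∑ i, c i} ≤
      ENNReal.ofReal (2 ^ (d - 1) * ∏ i, w i) := by
  obtain ⟨m, rfl⟩ : ∃ m, d = m + 1 := ⟨d - 1, by omega⟩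
  have h := two_mul_volume_half_box_le w
  have h2 : ∏ i, 2 * w i = 2 * (2 ^ (m + 1 - 1) * ∏ i, w i) := by
    rw [Finset.prod_mul_distrib]
    simp [pow_succ]; ring
  rw [h2, ENNReal.ofReal_mul (by norm_num), ENNReal.ofReal_ofNat] at h
  exact (ENNReal.mul_le_mul_iff_right (by norm_num) (by norm_num)).1 h

/-- The constraint at vertex 0 gives 1 - ∑ c_i ≤ 1, hence ∑ c_i ≥ 0, which replaces the box by a
half-box: 2^(d-1) instead of 2^d. The factor |det| is the Jacobian of `simplexParam`. -/
theorem volume_simplexDet_region_le {d : ℕ} (hd : 1 ≤ d)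
    {f : Fin (d + 1) → EuclideanSpace ℝ (Fin d)} (hf : simplexDet f ≠ 0)
    (w : Fin d → ℝ) (hw : ∀ i, 0 ≤ w i) :
    volume {y | |simplexDet (Function.update f 0 y)| ≤ |simplexDet f| ∧
      ∀ i : Fin d, |simplexDet (Function.update f i.succ y)| ≤ w i * |simplexDet f|} ≤
      ENNReal.ofReal (|simplexDet f| * (2 ^ (d - 1) * ∏ i, w i)) := by
  rw [ENNReal.ofReal_mul (abs_nonneg _)]
  refine le_trans (measure_mono ?_) ((volume_image_simplexParam f _).trans_le
    (mul_le_mul_right (volume_half_box_le hd w hw) _))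
  rintro y ⟨h0, h⟩
  have hpos : 0 < |simplexDet f| := abs_pos.2 hf
  obtain ⟨c, hc1, hcy, hc⟩ := exists_barycentric hf y
  rw [hc, abs_mul] at h0
  rw [Fin.sum_univ_succ] at hc1
  refine ⟨fun i => c i.succ, ⟨fun i => ?_, ?_⟩, ?_⟩
  · have := h i
    rw [hc, abs_mul] at this
    exact le_of_mul_le_mul_right this hpos
  · have : |c 0| ≤ 1 := le_of_mul_le_mul_right (by simpa using h0) hpos
    have := (abs_le.1 this).2
    linarith
  · rw [hcy, Fin.sum_univ_succ, simplexParam]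
    simp only [smul_sub, Finset.sum_sub_distrib, ← Finset.sum_smul]
    rw [show c 0 = 1 - ∑ i : Fin d, c i.succ by linarith, sub_smul, one_smul]
    abel

/-- The open ℓ¹ unit ball has volume 2^d/d! and is covered by the 2^d coordinate reflections of the
corner simplex. -/
theorem volume_corner_simplex_ge (d : ℕ) :
    ENNReal.ofReal (1 / (d.factorial : ℝ)) ≤
      volume {c : Fin d → ℝ | (∀ i, 0 ≤ c i) ∧ ∑ i, c i ≤ 1} := by
  set T := {c : Fin d → ℝ | (∀ i, 0 ≤ c i) ∧ ∑ i, c i ≤ 1} with hT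
  have hb := volume_sum_rpow_lt_one (Fin d) (le_refl (1 : ℝ))
  simp only [Real.rpow_one, Fintype.card_fin, div_one, Real.Gamma_nat_eq_factorial,
    show (1 : ℝ) + 1 = 2 by norm_num, Real.Gamma_two, mul_one] at hb
  have hpres : ∀ s : Fin d → Bool, MeasurePreserving
      (fun (c : Fin d → ℝ) i => bif s i then c i else -c i) volume volume := by
    intro s
    refine volume_preserving_pi (f := fun i (a : ℝ) => bif s i then a else -a) fun i => ?_
    cases s i
    · exact Measure.measurePreserving_neg _
    · exact MeasurePreserving.id _
  have hTm : MeasurableSet T := by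
    have : IsClosed T := by
      refine IsClosed.and ?_ (isClosed_le (by fun_prop) (by fun_prop))
      simp only [Set.ofPred_forall]
      exact isClosed_iInter fun i => isClosed_le (by fun_prop) (by fun_prop)
    exact this.measurableSet
  have hle : volume {x : Fin d → ℝ | ∑ i, |x i| < 1} ≤ (2 : ENNReal) ^ d * volume T := by
    calc volume {x : Fin d → ℝ | ∑ i, |x i| < 1}
        ≤ volume (⋃ s : Fin d → Bool, (fun (c : Fin d → ℝ) i => bif s i then c i else -c i) ⁻¹' T) := by
          refine measure_mono fun x hx => Set.mem_iUnion.2 ⟨fun i => decide (0 ≤ x i), ?_⟩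
          have : ∀ i, (bif decide (0 ≤ x i) then x i else -x i) = |x i| := by
            intro i
            by_cases h : 0 ≤ x i
            · simp [h, abs_of_nonneg]
            · simp [h, abs_of_neg (not_le.1 h)]
          simp only [Set.mem_preimage, this, hT, Set.mem_ofPred_eq]
          exact ⟨fun i => abs_nonneg _, le_of_lt hx⟩
      _ ≤ ∑ s : Fin d → Bool, volume T := by
          refine (measure_iUnion_fintype_le _ _).trans (Finset.sum_le_sum fun s _ => ?_)
          rw [(hpres s).measure_preimage hTm.nullMeasurableSet]
      _ = (2 : ENNReal) ^ d * volume T := by simp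
  rw [hb] at hle
  have h2 : (2 : ℝ) ^ d / d.factorial = 2 ^ d * (1 / d.factorial) := by ring
  rw [h2, ENNReal.ofReal_mul (by positivity), ENNReal.ofReal_pow (by norm_num),
    ENNReal.ofReal_ofNat] at hle
  exact (ENNReal.mul_le_mul_iff_right (by positivity) (by simp)).1 hle

theorem abs_simplexDet_div_factorial_le_volume {d : ℕ}
    (f : Fin (d + 1) → EuclideanSpace ℝ (Fin d)) :
    ENNReal.ofReal (|simplexDet f| / d.factorial) ≤ volume (convexHull ℝ (Set.range f)) := by
  rw [div_eq_mul_one_div, ENNReal.ofReal_mul (abs_nonneg _)]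
  refine (mul_le_mul_right (volume_corner_simplex_ge d) _).trans
    ((volume_image_simplexParam f _).symm.trans_le (measure_mono ?_))
  rintro _ ⟨c, ⟨h0, h1⟩, rfl⟩
  refine mem_convexHull_of_exists_fintype (Fin.cons (1 - ∑ i, c i) c) f ?_ ?_
    (fun i => Set.mem_range_self i) ?_
  · exact Fin.cases (by simpa using h1) (by simpa using h0)
  · simp [Fin.sum_univ_succ]
  · simp only [Fin.sum_univ_succ, Fin.cons_zero, Fin.cons_succ, simplexParam, smul_sub,
      Finset.sum_sub_distrib, ← Finset.sum_smul, sub_smul, one_smul]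
    abel

/-! ### Conditioning on all points but the last; general position -/

theorem measure_pi_eq_lintegral_snoc {α : Type*} [MeasurableSpace α] (μ : Measure α)
    [SigmaFinite μ] {m : ℕ} {S : Set (Fin (m + 1) → α)} (hS : MeasurableSet S) :
    Measure.pi (fun _ : Fin (m + 1) => μ) S =
      ∫⁻ b, μ {p | (Fin.snoc b p : Fin (m + 1) → α) ∈ S} ∂Measure.pi fun _ : Fin m => μ := by
  have h := (measurePreserving_piFinSuccAbove (fun _ : Fin (m + 1) => μ) (Fin.last m)).symm
  rw [← h.measure_preimage_equiv, Measure.prod_apply_symm (h.measurable hS)]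
  refine lintegral_congr fun b => congrArg μ (Set.ext fun p => ?_)
  simp [MeasurableEquiv.piFinSuccAbove, Fin.snocEquiv]

/-- Each new point almost surely avoids the span of the earlier ones, a proper subspace and hence a
null set. -/
theorem ae_linearIndependent {E : Type*} [NormedAddCommGroup E] [NormedSpace ℝ E]
    [FiniteDimensional ℝ E] [MeasurableSpace E] [BorelSpace E] (ν : Measure E)
    [ν.IsAddHaarMeasure] (μ : Measure E) [SigmaFinite μ] (hμ : μ ≪ ν) (m : ℕ)
    (hm : m ≤ Module.finrank ℝ E) :
    ∀ᵐ b ∂Measure.pi fun _ : Fin m => μ, LinearIndependent ℝ b := by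
  induction m with
  | zero => exact Eventually.of_forall fun b => linearIndependent_empty_type
  | succ m ih =>
    have hopen : IsOpen {b : Fin (m + 1) → E | LinearIndependent ℝ b} :=
      isOpen_setOfPred_linearIndependent
    rw [ae_iff]
    refine (measure_pi_eq_lintegral_snoc μ hopen.measurableSet.compl).trans ?_
    refine (lintegral_congr_ae (g := 0) ?_).trans lintegral_zero
    filter_upwards [ih (by omega)] with b hb
    refine hμ ?_
    refine measure_mono_null ?_
      (Measure.addHaar_submodule ν (Submodule.span ℝ (Set.range b)) fun h => ?_)
    · intro p hp
      by_contra hp2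
      exact hp (linearIndependent_finSnoc.2 ⟨hb, hp2⟩)
    · have := finrank_range_le_card (R := ℝ) b
      rw [Set.finrank, h, finrank_top, Fintype.card_fin] at this
      omega

/-! ### Probability that a fixed labelling is canonical -/

section Apex

variable {d : ℕ}

theorem simplexDet_snoc_zero_ne_zero {b : Fin d → EuclideanSpace ℝ (Fin d)}
    (hb : LinearIndependent ℝ b) :
    simplexDet (Fin.snoc b 0 : Fin (d + 1) → EuclideanSpace ℝ (Fin d)) ≠ 0 := by
  have h : (Fin.snoc b 0 : Fin (d + 1) → EuclideanSpace ℝ (Fin d)) =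
      (Fin.cons 0 b) ∘ finRotate (d + 1) := Fin.snoc_eq_cons_rotate _ _
  rw [← abs_ne_zero, h, abs_simplexDet_comp_perm, abs_ne_zero, simplexDet_eq_det_sub]
  have h2 : LinearIndependent ℝ (fun i => (b i).ofLp) :=
    hb.map' (WithLp.linearEquiv 2 ℝ (Fin d → ℝ)).toLinearMap (LinearEquiv.ker _)
  have h3 := (Matrix.linearIndependent_rows_iff_isUnit
    (A := Matrix.of fun i j : Fin d => b i j)).1 h2
  simpa using ((Matrix.isUnit_iff_isUnit_det _).1 h3).ne_zero

/-- The last point of `f` is, seen from the origin, dominated by the others, and the simplex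
spanned by `f` is small. -/
def IsApex (s : ℝ) (f : Fin (d + 1) → EuclideanSpace ℝ (Fin d)) : Prop :=
  (∀ i : Fin d, |simplexDet (Function.update
      (Fin.snoc (Fin.init f) 0 : Fin (d + 1) → EuclideanSpace ℝ (Fin d)) i.castSucc
      (f (Fin.last d)))| ≤
    |simplexDet (Fin.snoc (Fin.init f) 0 : Fin (d + 1) → EuclideanSpace ℝ (Fin d))|) ∧
  |simplexDet f| ≤ s

theorem continuous_snoc_init : Continuous fun f : Fin (d + 1) → EuclideanSpace ℝ (Fin d) =>
    (Fin.snoc (Fin.init f) 0 : Fin (d + 1) → EuclideanSpace ℝ (Fin d)) := by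
  refine continuous_pi fun i => ?_
  refine Fin.lastCases ?_ (fun i => ?_) i
  · simpa using continuous_const
  · simpa [Fin.init] using continuous_apply _

theorem isClosed_isApex (s : ℝ) :
    IsClosed {f : Fin (d + 1) → EuclideanSpace ℝ (Fin d) | IsApex s f} := by
  refine IsClosed.and ?_ (isClosed_le continuous_simplexDet.abs continuous_const)
  simp only [Set.ofPred_forall]
  exact isClosed_iInter fun i => isClosed_le
    (continuous_simplexDet.comp
      (continuous_snoc_init.update i.castSucc (continuous_apply _))).abs
    (continuous_simplexDet.comp continuous_snoc_init).abs

theorem measure_isApex_le (hd : 1 ≤ d) (μ : Measure (EuclideanSpace ℝ (Fin d)))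
    [IsProbabilityMeasure μ] (hμ : μ ≤ volume) {s : ℝ} (hs : 0 ≤ s) :
    Measure.pi (fun _ : Fin (d + 1) => μ) {f | IsApex s f} ≤ ENNReal.ofReal (2 ^ (d - 1) * s) := by
  rw [measure_pi_eq_lintegral_snoc μ (isClosed_isApex s).measurableSet]
  calc _ ≤ ∫⁻ b, ENNReal.ofReal (2 ^ (d - 1) * s) ∂Measure.pi fun _ : Fin d => μ := ?_
    _ = _ := by simp
  refine lintegral_mono_ae ?_
  filter_upwards [ae_linearIndependent volume μ (Measure.absolutelyContinuous_of_le hμ) d (by simp)]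
    with b hb
  have hD := simplexDet_snoc_zero_ne_zero hb
  obtain ⟨m, rfl⟩ : ∃ m, d = m + 1 := ⟨d - 1, by omega⟩
  set D := simplexDet (Fin.snoc b 0 : Fin (m + 1 + 1) → EuclideanSpace ℝ (Fin (m + 1))) with hDdef
  have hDpos : 0 < |D| := abs_pos.2 hD
  -- The reference simplex is (b, 0): weight 1 on the points of b, and s/|D| on the origin, since
  -- replacing the origin by p gives the determinant of (b, p).
  refine (hμ _).trans (le_trans (measure_mono ?_) ((volume_simplexDet_region_le hd hD
    (Fin.snoc (fun _ => 1) (s / |D|)) ?_).trans_eq ?_))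
  · rintro p ⟨h1, h2⟩
    simp only [Fin.init_snoc, Fin.snoc_last] at h1
    refine ⟨h1 0, fun i => ?_⟩
    refine Fin.lastCases ?_ (fun i => ?_) i
    · rw [Fin.succ_last, Fin.update_snoc_last, Fin.snoc_last, div_mul_cancel₀ _ hDpos.ne']
      exact h2
    · rw [Fin.snoc_castSucc, one_mul, ← Fin.castSucc_succ]
      exact h1 _
  · exact Fin.lastCases (by simpa using by positivity) (by simp)
  · congr 1
    rw [Fin.prod_univ_castSucc]
    simp only [Fin.snoc_castSucc, Finset.prod_const_one, one_mul, Fin.snoc_last, ← hDdef]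
    field_simp

/-- The points indexed by `Fin (d + 1)` span a simplex of maximal volume among those that differ in
one point, with `IsApex` vertices. -/
def IsCanonical {r : ℕ} (s : ℝ) (x : Fin (d + 1) ⊕ Fin r → EuclideanSpace ℝ (Fin d)) : Prop :=
  IsApex s (x ∘ Sum.inl) ∧ ∀ j i, |simplexDet (Function.update (x ∘ Sum.inl) i (x (Sum.inr j)))| ≤
    |simplexDet (x ∘ Sum.inl)|

theorem isClosed_isCanonical {r : ℕ} (s : ℝ) :
    IsClosed {x : Fin (d + 1) ⊕ Fin r → EuclideanSpace ℝ (Fin d) | IsCanonical s x} := by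
  have hc : Continuous fun x : Fin (d + 1) ⊕ Fin r → EuclideanSpace ℝ (Fin d) => x ∘ Sum.inl := by
    fun_prop
  refine IsClosed.and ((isClosed_isApex s).preimage hc) ?_
  simp only [Set.ofPred_forall]
  exact isClosed_iInter fun j => isClosed_iInter fun i => isClosed_le
    (continuous_simplexDet.comp (hc.update i (continuous_apply _))).abs
    (continuous_simplexDet.comp hc).abs

/-- Given the first d+1 points, the other r are independent, each confined to a region of volume at
most 2^(d-1) s; the apex contributes one more such factor. -/
theorem measure_isCanonical_le (hd : 1 ≤ d) (μ : Measure (EuclideanSpace ℝ (Fin d)))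
    [IsProbabilityMeasure μ] (hμ : μ ≤ volume) (r : ℕ) {s : ℝ} (hs : 0 ≤ s) :
    Measure.pi (fun _ : Fin (d + 1) ⊕ Fin r => μ) {x | IsCanonical s x} ≤
      ENNReal.ofReal (2 ^ (d - 1) * s) ^ (r + 1) := by
  have hpres := (measurePreserving_sumPiEquivProdPi (fun _ : Fin (d + 1) ⊕ Fin r => μ)).symm
  rw [← hpres.measure_preimage_equiv,
    Measure.prod_apply (hpres.measurable (isClosed_isCanonical s).measurableSet)]
  have hne : ∀ᵐ f ∂Measure.pi (fun _ : Fin (d + 1) => μ), IsApex s f → simplexDet f ≠ 0 := by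
    rw [ae_iff]
    -- A degenerate apex configuration satisfies `IsApex 0`, to which the previous bound assigns
    -- measure 0.
    refine measure_mono_null (t := {f | IsApex 0 f}) ?_ ?_
    · intro f hf
      simp only [Set.mem_ofPred_eq, Classical.not_imp, not_not] at hf
      exact ⟨hf.1.1, by simp [hf.2]⟩
    · simpa using measure_isApex_le hd μ hμ le_rfl
  calc _ ≤ ∫⁻ f in {f | IsApex s f}, ENNReal.ofReal (2 ^ (d - 1) * s) ^ r
          ∂Measure.pi fun _ : Fin (d + 1) => μ := ?_
    _ = ENNReal.ofReal (2 ^ (d - 1) * s) ^ r *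
          Measure.pi (fun _ : Fin (d + 1) => μ) {f | IsApex s f} := setLIntegral_const _ _
    _ ≤ _ := by
      rw [pow_succ]
      exact mul_le_mul_right (measure_isApex_le hd μ hμ hs) _
  rw [← lintegral_indicator (isClosed_isApex s).measurableSet]
  refine lintegral_mono_ae ?_
  filter_upwards [hne] with f hf
  by_cases hA : IsApex s f
  swap
  · rw [Set.indicator_of_notMem (s := {f | IsApex s f}) hA]
    refine (measure_mono_null ?_ measure_empty).le
    intro y hy
    exact hA hy.1
  have hD := hf hA
  rw [Set.indicator_of_mem (s := {f | IsApex s f}) hA]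
  set R := {y | |simplexDet (Function.update f 0 y)| ≤ |simplexDet f| ∧
      ∀ i : Fin d, |simplexDet (Function.update f i.succ y)| ≤ 1 * |simplexDet f|} with hR
  calc _ ≤ Measure.pi (fun _ : Fin r => μ) (Set.pi Set.univ fun _ => R) := by
        refine measure_mono fun y hy j _ => ?_
        have h2 := hy.2 j
        refine ⟨h2 0, fun i => ?_⟩
        rw [one_mul]
        exact h2 _
    _ = μ R ^ r := by rw [Measure.pi_pi]; simp
    _ ≤ _ := by
        refine pow_le_pow_left' ((hμ _).trans ((volume_simplexDet_region_le hd hD (fun _ => 1)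
          (by simp)).trans (ENNReal.ofReal_le_ofReal ?_))) r
        rw [Finset.prod_const_one, mul_one, mul_comm]
        exact mul_le_mul_of_nonneg_left hA.2 (by positivity)

end Apex

/-! ### Existence and number of canonical labellings -/

/-- The extension of a permutation of `Fin d` to `Fin (d + 1)` that fixes the last element. -/
def permFixLast {d : ℕ} (τ : Equiv.Perm (Fin d)) : Equiv.Perm (Fin (d + 1)) :=
  finSuccEquivLast.trans ((Equiv.optionCongr τ).trans finSuccEquivLast.symm)

@[simp] theorem permFixLast_castSucc {d : ℕ} (τ : Equiv.Perm (Fin d)) (i : Fin d) :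
    permFixLast τ i.castSucc = (τ i).castSucc := by
  simp [permFixLast]

@[simp] theorem permFixLast_last {d : ℕ} (τ : Equiv.Perm (Fin d)) :
    permFixLast τ (Fin.last d) = Fin.last d := by
  simp [permFixLast]

theorem permFixLast_injective {d : ℕ} : Function.Injective (permFixLast (d := d)) := by
  intro τ₁ τ₂ h
  ext i
  have := congrArg (fun σ : Equiv.Perm (Fin (d + 1)) => σ i.castSucc) h
  simp only [permFixLast_castSucc, Fin.castSucc_inj] at this
  rw [this]

theorem snoc_init_comp_permFixLast {d : ℕ} {α : Type*} (f : Fin (d + 1) → α) (a : α)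
    (τ : Equiv.Perm (Fin d)) :
    (Fin.snoc (Fin.init (f ∘ permFixLast τ)) a : Fin (d + 1) → α) =
      (Fin.snoc (Fin.init f) a : Fin (d + 1) → α) ∘ permFixLast τ := by
  ext i
  refine Fin.lastCases ?_ (fun i => ?_) i <;> simp [Fin.init]

theorem IsApex.comp_permFixLast {d : ℕ} {s : ℝ} {f : Fin (d + 1) → EuclideanSpace ℝ (Fin d)}
    (hf : IsApex s f) (τ : Equiv.Perm (Fin d)) : IsApex s (f ∘ permFixLast τ) := by
  refine ⟨fun i => ?_, ?_⟩
  · rw [snoc_init_comp_permFixLast, abs_simplexDet_comp_perm]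
    have h := Function.update_comp_equiv (Fin.snoc (Fin.init f) 0 :
      Fin (d + 1) → EuclideanSpace ℝ (Fin d)) (permFixLast τ) (τ i).castSucc (f (Fin.last d))
    rw [← permFixLast_castSucc, Equiv.symm_apply_apply] at h
    rw [Function.comp_apply, permFixLast_last, ← h, abs_simplexDet_comp_perm,
      permFixLast_castSucc]
    exact hf.1 _
  · rw [abs_simplexDet_comp_perm]
    exact hf.2

/-- Two-stage maximization: first the simplex determinant, then, among its maximizers, the
determinant of the first d points with the origin. -/
theorem exists_isCanonical {d r : ℕ} {ι : Type*} [Finite ι]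
    (σ₁ : Fin (d + 1) ⊕ Fin r ≃ ι) {s : ℝ} {x : ι → EuclideanSpace ℝ (Fin d)}
    (hx : ∀ e : Fin (d + 1) → ι, |simplexDet (x ∘ e)| ≤ s) :
    ∃ σ : Fin (d + 1) ⊕ Fin r ≃ ι, IsCanonical s (x ∘ σ) := by
  let g₁ : (Fin (d + 1) ⊕ Fin r ≃ ι) → ℝ := fun σ => |simplexDet ((x ∘ σ) ∘ Sum.inl)|
  let g₂ : (Fin (d + 1) ⊕ Fin r ≃ ι) → ℝ := fun σ => |simplexDet
    (Fin.snoc (Fin.init ((x ∘ σ) ∘ Sum.inl)) 0 : Fin (d + 1) → EuclideanSpace ℝ (Fin d))|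
  have : Nonempty (Fin (d + 1) ⊕ Fin r ≃ ι) := ⟨σ₁⟩
  obtain ⟨σ₀, h₀⟩ := Finite.exists_max g₁
  have : Nonempty {σ // g₁ σ = g₁ σ₀} := ⟨⟨σ₀, rfl⟩⟩
  obtain ⟨⟨σ, hσ⟩, h₁⟩ := Finite.exists_max fun σ : {σ // g₁ σ = g₁ σ₀} => g₂ σ
  refine ⟨σ, ⟨fun i => ?_, hx (σ ∘ Sum.inl)⟩, fun j i => ?_⟩
  -- Swapping the apex with another vertex preserves |det|, so the swapped labelling competes in the
  -- second stage.
  · have hp : g₁ ((Equiv.swap (Sum.inl i.castSucc) (Sum.inl (Fin.last d))).trans σ) = g₁ σ₀ := by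
      rw [← hσ]
      simp only [g₁]
      rw [← abs_simplexDet_comp_perm ((x ∘ σ) ∘ Sum.inl) (Equiv.swap i.castSucc (Fin.last d))]
      congr 2
      ext1 a
      simp only [Function.comp_apply, Equiv.trans_apply]
      rw [← Sum.inl_injective.map_swap]
    have h := h₁ ⟨_, hp⟩
    refine le_trans (le_of_eq ?_) h
    simp only [g₂]
    congr 2
    ext1 a
    refine Fin.lastCases ?_ (fun a => ?_) a
    · simp [(Fin.castSucc_lt_last i).ne']
    · rcases eq_or_ne a i with rfl | ha
      · simp [Fin.init]
      · have h1 : a.castSucc ≠ i.castSucc := fun h => ha (Fin.castSucc_injective _ h)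
        have h2 : a.castSucc ≠ Fin.last d := (Fin.castSucc_lt_last a).ne
        rw [Function.update_of_ne h1, Fin.snoc_castSucc, Fin.snoc_castSucc]
        simp only [Fin.init, Function.comp_apply, Equiv.trans_apply]
        rw [Equiv.swap_apply_of_ne_of_ne (by simpa using ha) (by simp)]
  · have h := h₀ ((Equiv.swap (Sum.inl i) (Sum.inr j)).trans σ)
    rw [← hσ] at h
    refine le_trans (le_of_eq ?_) h
    simp only [g₁]
    congr 2
    ext1 a
    rcases eq_or_ne a i with rfl | ha
    · simp
    · rw [Function.update_of_ne ha]
      simp only [Function.comp_apply, Equiv.trans_apply]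
      rw [Equiv.swap_apply_of_ne_of_ne (by simpa using ha) (by simp)]

/-- Permuting the first d points changes neither the apex nor any absolute determinant up to
reindexing, so one canonical labelling yields d! of them. -/
theorem factorial_le_card_isCanonical {d r : ℕ} {ι : Type*} [Fintype ι] [DecidableEq ι]
    (σ₁ : Fin (d + 1) ⊕ Fin r ≃ ι) {s : ℝ} {x : ι → EuclideanSpace ℝ (Fin d)}
    (hx : ∀ e : Fin (d + 1) → ι, |simplexDet (x ∘ e)| ≤ s)
    [DecidablePred fun σ : Fin (d + 1) ⊕ Fin r ≃ ι => IsCanonical s (x ∘ σ)] :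
    d.factorial ≤ Fintype.card {σ : Fin (d + 1) ⊕ Fin r ≃ ι // IsCanonical s (x ∘ σ)} := by
  obtain ⟨σ, hσ⟩ := exists_isCanonical σ₁ hx
  have h := Fintype.card_le_of_injective
    (fun τ : Equiv.Perm (Fin d) =>
      (⟨((permFixLast τ).sumCongr (Equiv.refl _)).trans σ, ?_⟩ :
        {σ : Fin (d + 1) ⊕ Fin r ≃ ι // IsCanonical s (x ∘ σ)})) ?_
  · rwa [Fintype.card_perm, Fintype.card_fin] at h
  · refine ⟨hσ.1.comp_permFixLast τ, fun j i => ?_⟩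
    have h1 : (x ∘ ((permFixLast τ).sumCongr (Equiv.refl _)).trans σ) ∘ Sum.inl =
      ((x ∘ σ) ∘ Sum.inl) ∘ permFixLast τ := rfl
    have h := Function.update_comp_equiv ((x ∘ σ) ∘ Sum.inl) (permFixLast τ) (permFixLast τ i)
      ((x ∘ σ) (Sum.inr j))
    rw [Equiv.symm_apply_apply] at h
    rw [h1, abs_simplexDet_comp_perm]
    have h2 : (x ∘ ((permFixLast τ).sumCongr (Equiv.refl _)).trans σ) (Sum.inr j) =
      (x ∘ σ) (Sum.inr j) := rfl
    rw [h2, ← h, abs_simplexDet_comp_perm]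
    exact hσ.2 _ _
  · intro τ₁ τ₂ h
    refine permFixLast_injective (Equiv.ext fun i => ?_)
    have h' := congrArg (fun σ' : {σ : Fin (d + 1) ⊕ Fin r ≃ ι // IsCanonical s (x ∘ σ)} =>
      σ.symm (σ'.1 (Sum.inl i))) h
    simpa using h'

/-- Double counting: integrate the number of canonical labellings, which is at least d! on the event
and has mean at most (d+1+r)! times the bound for one labelling. -/
theorem factorial_mul_measure_simplexDet_le {d r : ℕ} (hd : 1 ≤ d) {ι : Type*} [Fintype ι]
    (hι : Fintype.card ι = d + 1 + r)
    (μ : Measure (EuclideanSpace ℝ (Fin d))) [IsProbabilityMeasure μ] (hμ : μ ≤ volume)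
    {s : ℝ} (hs : 0 ≤ s) :
    d.factorial * Measure.pi (fun _ : ι => μ)
        {x | ∀ e : Fin (d + 1) → ι, |simplexDet (x ∘ e)| ≤ s} ≤
      (d + 1 + r).factorial * ENNReal.ofReal (2 ^ (d - 1) * s) ^ (r + 1) := by
  classical
  have σ₁ : Fin (d + 1) ⊕ Fin r ≃ ι := Fintype.equivOfCardEq (by simp [hι])
  set S := {x : ι → EuclideanSpace ℝ (Fin d) |
    ∀ e : Fin (d + 1) → ι, |simplexDet (x ∘ e)| ≤ s} with hS
  let C : (Fin (d + 1) ⊕ Fin r ≃ ι) → Set (ι → EuclideanSpace ℝ (Fin d)) :=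
    fun σ => {x | IsCanonical s (x ∘ σ)}
  have hcomp : ∀ σ : Fin (d + 1) ⊕ Fin r ≃ ι,
      Continuous fun x : ι → EuclideanSpace ℝ (Fin d) => x ∘ σ := fun σ => by fun_prop
  have hCm : ∀ σ, MeasurableSet (C σ) := fun σ =>
    ((isClosed_isCanonical s).preimage (hcomp σ)).measurableSet
  have hC : ∀ σ, Measure.pi (fun _ : ι => μ) (C σ) ≤
      ENNReal.ofReal (2 ^ (d - 1) * s) ^ (r + 1) := by
    intro σ
    refine le_trans (le_of_eq ?_) (measure_isCanonical_le hd μ hμ r hs)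
    have hp := (measurePreserving_piCongrLeft (fun _ : ι => μ) σ).symm
    rw [← hp.measure_preimage_equiv]
    rfl
  have hSm : MeasurableSet S := by
    refine IsClosed.measurableSet ?_
    simp only [hS, Set.ofPred_forall]
    exact isClosed_iInter fun e => isClosed_le
      (continuous_simplexDet.comp (by fun_prop)).abs continuous_const
  calc d.factorial * Measure.pi (fun _ : ι => μ) S
      = ∫⁻ x in S, d.factorial ∂Measure.pi (fun _ : ι => μ) := (setLIntegral_const _ _).symm
    _ ≤ ∫⁻ x in S, ∑ σ, (C σ).indicator 1 x ∂Measure.pi (fun _ : ι => μ) := by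
        refine setLIntegral_mono' hSm fun x hx => ?_
        have h := factorial_le_card_isCanonical σ₁ hx
        rw [Fintype.card_subtype] at h
        simp only [Set.indicator_apply, Finset.sum_ite, Finset.sum_const_zero, add_zero,
          Pi.one_apply, Finset.sum_const, nsmul_eq_mul, mul_one]
        exact_mod_cast h
    _ ≤ ∫⁻ x, ∑ σ, (C σ).indicator 1 x ∂Measure.pi (fun _ : ι => μ) := setLIntegral_le_lintegral _ _
    _ = ∑ σ, Measure.pi (fun _ : ι => μ) (C σ) := by
        rw [lintegral_finsetSum _ fun σ _ => measurable_one.indicator (hCm σ)]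
        exact Finset.sum_congr rfl fun σ _ => lintegral_indicator_one (hCm σ)
    _ ≤ ∑ _σ : Fin (d + 1) ⊕ Fin r ≃ ι, ENNReal.ofReal (2 ^ (d - 1) * s) ^ (r + 1) :=
        Finset.sum_le_sum fun σ _ => hC σ
    _ = _ := by
        rw [Finset.sum_const, Finset.card_univ, Fintype.card_equiv σ₁]
        simp

/-! ### The tail of the hull volume -/

theorem measure_convexHull_le {d k : ℕ} (hd : 1 ≤ d) (hk : d + 1 ≤ k) {ι : Type*} [Fintype ι]
    (hι : Fintype.card ι = k) {K : Set (EuclideanSpace ℝ (Fin d))} (hKm : MeasurableSet K)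
    (hKc : Convex ℝ K) (hK : volume K = 1) {t : ℝ} (ht : 0 ≤ t) :
    Measure.pi (fun _ : ι => volume.restrict K)
        {x | (volume.restrict K).real (convexHull ℝ (Set.range x)) ≤ t} ≤
      ENNReal.ofReal (k.factorial / d.factorial * (2 ^ (d - 1) * d.factorial * t) ^ (k - d)) := by
  obtain ⟨r, rfl⟩ := Nat.exists_eq_add_of_le hk
  have hprob : IsProbabilityMeasure (volume.restrict K) := ⟨by simpa using hK⟩
  have hdf : (0 : ℝ) < d.factorial := by exact_mod_cast d.factorial_pos
  have h := factorial_mul_measure_simplexDet_le hd hι (volume.restrict K) Measure.restrict_le_self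
    (s := d.factorial * t) (by positivity)
  have hle : Measure.pi (fun _ : ι => volume.restrict K)
        {x | (volume.restrict K).real (convexHull ℝ (Set.range x)) ≤ t} ≤
      Measure.pi (fun _ : ι => volume.restrict K)
        {x | ∀ e : Fin (d + 1) → ι, |simplexDet (x ∘ e)| ≤ d.factorial * t} := by
    refine measure_mono_ae ?_
    -- Almost surely all points lie in K; by convexity so do their simplices, and the restricted
    -- measure sees the full simplex volume.
    have hae : ∀ᵐ x ∂Measure.pi (fun _ : ι => volume.restrict K), ∀ i, x i ∈ K := by
      rw [← Measure.restrict_pi_pi]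
      filter_upwards [ae_restrict_mem (MeasurableSet.univ_pi fun _ => hKm)] with x hx i
      exact hx i trivial
    filter_upwards [hae] with x hx hxt e
    have hxt : (volume.restrict K).real (convexHull ℝ (Set.range x)) ≤ t := hxt
    have hsub : convexHull ℝ (Set.range (x ∘ e)) ⊆ K :=
      convexHull_min (by rintro _ ⟨i, rfl⟩; exact hx _) hKc
    have h1 := abs_simplexDet_div_factorial_le_volume (x ∘ e)
    have h2 : volume (convexHull ℝ (Set.range (x ∘ e))) ≤
        (volume.restrict K) (convexHull ℝ (Set.range x)) := by
      rw [← Measure.restrict_eq_self volume hsub]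
      exact measure_mono (convexHull_mono (Set.range_comp_subset_range _ _))
    have h3 := ENNReal.toReal_mono (measure_ne_top _ _) (h1.trans h2)
    rw [ENNReal.toReal_ofReal (by positivity)] at h3
    have h4 := h3.trans hxt
    rw [div_le_iff₀ hdf] at h4
    linarith
  refine hle.trans ?_
  rw [div_mul_eq_mul_div, ENNReal.ofReal_div_of_pos hdf, ENNReal.le_div_iff_mul_le
    (Or.inl (by simpa using d.factorial_ne_zero)) (Or.inl (by simp)), ENNReal.ofReal_natCast, mul_comm]
  refine h.trans_eq ?_
  rw [ENNReal.ofReal_mul (Nat.cast_nonneg _), ENNReal.ofReal_natCast,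
    ENNReal.ofReal_pow (by positivity), show d + 1 + r - d = r + 1 by omega, mul_assoc]

/-! ### From the tail to a moment: beta integral and layer cake -/

theorem integral_pow_mul_one_sub_pow (a q : ℕ) :
    ∫ t in (0 : ℝ)..1, t ^ a * (1 - t) ^ q =
      (a.factorial * q.factorial : ℝ) / (a + q + 1).factorial := by
  induction q generalizing a with
  | zero =>
    simp [Nat.factorial_succ]
    field_simp
  | succ q ih =>
    have h := intervalIntegral.integral_mul_deriv_eq_deriv_mul (a := 0) (b := 1)
      (u := fun t : ℝ => (1 - t) ^ (q + 1)) (u' := fun t => -((q + 1) * (1 - t) ^ q))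
      (v := fun t : ℝ => t ^ (a + 1) / (a + 1)) (v' := fun t => t ^ a)
      (fun t _ => by
        have := ((hasDerivAt_id' t).const_sub 1).fun_pow (q + 1)
        convert this using 1
        push_cast [Nat.add_sub_cancel]
        ring)
      (fun t _ => by
        have := ((hasDerivAt_id' t).fun_pow (a + 1)).div_const ((a : ℝ) + 1)
        convert this using 1
        push_cast [Nat.add_sub_cancel]
        field_simp)
      (Continuous.intervalIntegrable (by fun_prop) _ _)
      (Continuous.intervalIntegrable (by fun_prop) _ _)
    have h2 : ∀ t : ℝ, -((q + 1) * (1 - t) ^ q) * (t ^ (a + 1) / (a + 1)) =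
        -((q + 1) / (a + 1)) * (t ^ (a + 1) * (1 - t) ^ q) := fun t => by
      field_simp
    simp only [h2, intervalIntegral.integral_const_mul, ih] at h
    simp only [mul_comm (_ ^ a)]
    rw [h]
    have : a + 1 + q + 1 = a + (q + 1) + 1 := by ring
    rw [this, Nat.factorial_succ a, Nat.factorial_succ q]
    push_cast
    field_simp
    simp

theorem lintegral_one_sub_pow_le {α : Type*} [MeasurableSpace α] (ν : Measure α)
    [IsProbabilityMeasure ν] {V : α → ℝ} (hVm : Measurable V) (hV0 : ∀ x, 0 ≤ V x)
    (hV1 : ∀ x, V x ≤ 1) {C : ℝ} (hC : 0 ≤ C) {q : ℕ}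
    (h : ∀ t, 0 ≤ t → ν {x | V x ≤ t} ≤ ENNReal.ofReal (C * t ^ q)) (N : ℕ) :
    ∫⁻ x, ENNReal.ofReal ((1 - V x) ^ N) ∂ν ≤
      ENNReal.ofReal (C * ((q.factorial * N.factorial : ℝ) / (N + q).factorial)) := by
  -- The layer-cake density is the derivative of t^N, so N = 0 is treated apart: the claim is then 1
  -- ≤ C, the tail bound at t = 1.
  rcases N with _ | N
  · have h1 := h 1 zero_le_one
    simp only [hV1, Set.ofPred_true, measure_univ, one_pow, mul_one] at h1
    simpa [(Nat.cast_ne_zero (R := ℝ)).2 q.factorial_ne_zero] using h1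
  have hlc := lintegral_comp_eq_lintegral_meas_le_mul ν (f := fun x => 1 - V x)
    (g := fun t => (N + 1) * t ^ N) (Eventually.of_forall fun x => sub_nonneg.2 (hV1 x))
    (by fun_prop) (fun t _ => Continuous.intervalIntegrable (by fun_prop) _ _)
    ((ae_restrict_iff' measurableSet_Ioi).2 (Eventually.of_forall fun t (ht : 0 < t) => by
      positivity))
  have hint : ∀ x, ∫ t in (0 : ℝ)..(1 - V x), ((N : ℝ) + 1) * t ^ N = (1 - V x) ^ (N + 1) := by
    intro x
    rw [intervalIntegral.integral_const_mul, integral_pow]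
    field_simp
    simp
  simp only [hint] at hlc
  rw [hlc]
  have hnn : ∀ t ∈ Set.Ioc (0 : ℝ) 1, 0 ≤ (t ^ N * (1 - t) ^ q) := fun t ht =>
    mul_nonneg (pow_nonneg ht.1.le _) (pow_nonneg (sub_nonneg.2 ht.2) _)
  calc _ ≤ ∫⁻ t in Set.Ioi 0, (Set.Ioc (0 : ℝ) 1).indicator
          (fun t => ENNReal.ofReal (C * (N + 1) * (t ^ N * (1 - t) ^ q))) t := by
        refine setLIntegral_mono' measurableSet_Ioi fun t ht => ?_
        by_cases ht1 : t ≤ 1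
        · rw [Set.indicator_of_mem (s := Set.Ioc (0 : ℝ) 1) ⟨ht, ht1⟩]
          have hs : {x | t ≤ 1 - V x} = {x | V x ≤ 1 - t} := by
            ext x
            exact ⟨fun (h : t ≤ 1 - V x) => show V x ≤ 1 - t by linarith,
              fun (h : V x ≤ 1 - t) => show t ≤ 1 - V x by linarith⟩
          rw [hs]
          refine (mul_le_mul_left (h _ (sub_nonneg.2 ht1)) _).trans_eq ?_
          rw [← ENNReal.ofReal_mul (mul_nonneg hC (pow_nonneg (sub_nonneg.2 ht1) _))]
          congr 1; ring
        · have hs : {x | t ≤ 1 - V x} = ∅ := by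
            ext x
            simp only [Set.mem_ofPred_eq, Set.mem_empty_iff_false, iff_false]
            linarith [hV0 x]
          simp [hs]
    _ ≤ ∫⁻ t in Set.Ioc 0 1, ENNReal.ofReal (C * (N + 1) * (t ^ N * (1 - t) ^ q)) := by
        rw [← lintegral_indicator measurableSet_Ioc]
        exact setLIntegral_le_lintegral _ _
    _ = ENNReal.ofReal (∫ t in Set.Ioc (0 : ℝ) 1, C * (N + 1) * (t ^ N * (1 - t) ^ q)) := by
        refine (ofReal_integral_eq_lintegral_ofReal ?_ ?_).symm
        · have : Continuous fun t : ℝ => C * (N + 1) * (t ^ N * (1 - t) ^ q) := by fun_prop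
          exact (this.intervalIntegrable 0 1).1
        · exact (ae_restrict_iff' measurableSet_Ioc).2 (Eventually.of_forall fun t ht =>
            mul_nonneg (by positivity) (hnn t ht))
    _ = _ := by
        rw [← intervalIntegral.integral_of_le zero_le_one, intervalIntegral.integral_const_mul,
          integral_pow_mul_one_sub_pow, Nat.factorial_succ N, show N + 1 + q = N + q + 1 by ring]
        congr 1
        push_cast
        ring

/-! ### Islands as measurable events -/

/-- The set is the projection of a closed set along the compact standard simplex of weights. This
yields measurability of the hull volume and of the island events. -/
theorem isClosed_mem_convexHull_range {ι E : Type*} [Fintype ι] [NormedAddCommGroup E]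
    [NormedSpace ℝ E] : IsClosed {y : (ι → E) × E | y.2 ∈ convexHull ℝ (Set.range y.1)} := by
  have h1 : IsClosed {z : stdSimplex ℝ ι × ((ι → E) × E) | ∑ i, z.1.1 i • z.2.1 i = z.2.2} :=
    isClosed_eq (continuous_finsetSum _ fun i _ => Continuous.smul
      ((continuous_apply i).comp (continuous_subtype_val.comp continuous_fst)) (by fun_prop))
      (by fun_prop)
  have h2 := isClosedMap_snd_of_compactSpace _ h1
  convert h2 using 1
  ext ⟨x, p⟩
  constructor
  · intro h
    have h : p ∈ convexHull ℝ (Set.range x) := h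
    classical
    have hr : Set.range x = Fintype.linearCombination ℝ x ''
        Set.range fun i j => if i = j then (1 : ℝ) else 0 := by
      rw [← Set.range_comp]
      congr 1
      ext1 i
      simp [Fintype.linearCombination_apply]
    rw [hr, ← LinearMap.image_convexHull, convexHull_basis_eq_stdSimplex] at h
    obtain ⟨w, hw, rfl⟩ := h
    exact ⟨(⟨w, hw⟩, (x, _)), (Fintype.linearCombination_apply ℝ x w).symm, rfl⟩
  · rintro ⟨⟨w, y⟩, hw, rfl⟩
    exact mem_convexHull_of_exists_fintype w.1 x w.2.1 w.2.2 (fun i => Set.mem_range_self i) hw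

/-- The event that the points with index in `A` form an island. -/
def islandEvent {ι E : Type*} [AddCommGroup E] [Module ℝ E] (A : Finset ι) : Set (ι → E) :=
  {x | ∀ j ∉ A, x j ∉ convexHull ℝ (x '' A)}

/-- For distinct points, islands correspond bijectively to their index sets. -/
theorem numIslands_range {d : ℕ} {ι : Type*} [Fintype ι] (k : ℕ)
    {x : ι → EuclideanSpace ℝ (Fin d)} (hx : Function.Injective x) :
    (numIslands k (Set.range x) : ℝ) =
      ∑ A ∈ Finset.powersetCard k (Finset.univ : Finset ι), (islandEvent A).indicator 1 x := by
  classical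
  have h : {I | IsIsland k (Set.range x) I} = (fun A : Finset ι => x '' (A : Set ι)) ''
      ((Finset.powersetCard k (Finset.univ : Finset ι)).filter
        fun A => x ∈ islandEvent A : Finset (Finset ι)) := by
    ext I
    constructor
    · rintro ⟨h1, h2, h3, h4⟩
      refine ⟨(Set.toFinite (x ⁻¹' I)).toFinset, ?_, ?_⟩
      · simp only [Finset.coe_filter, Finset.mem_powersetCard_univ, Set.mem_ofPred_eq]
        refine ⟨?_, fun j hj => ?_⟩
        · rw [← Set.ncard_eq_toFinset_card, ← h3,
            Set.ncard_preimage_of_injective_subset_range hx h1]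
        · rw [Set.Finite.coe_toFinset, Set.image_preimage_eq_of_subset h1]
          intro hj2
          refine hj ?_
          rw [Set.Finite.mem_toFinset, Set.mem_preimage, ← h4]
          exact ⟨hj2, Set.mem_range_self j⟩
      · simp only [Set.Finite.coe_toFinset]
        exact Set.image_preimage_eq_of_subset h1
    · rintro ⟨A, hA, rfl⟩
      simp only [Finset.coe_filter, Finset.mem_powersetCard_univ, Set.mem_ofPred_eq] at hA
      refine ⟨Set.image_subset_range _ _, Set.toFinite _, ?_, ?_⟩
      · rw [Set.ncard_image_of_injective _ hx, Set.ncard_coe_finset, hA.1]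
      · refine Set.Subset.antisymm ?_ fun y hy =>
          ⟨subset_convexHull ℝ _ hy, Set.image_subset_range _ _ hy⟩
        rintro _ ⟨hy, j, rfl⟩
        by_contra hj
        exact hA.2 j (fun hjA => hj ⟨j, hjA, rfl⟩) hy
  rw [numIslands, h, Set.ncard_image_of_injective, Set.ncard_coe_finset]
  · simp [Set.indicator_apply]
  · intro A B hAB
    exact Finset.coe_injective (hx.image_injective hAB)

theorem measurableSet_islandEvent {ι E : Type*} [Fintype ι] [NormedAddCommGroup E]
    [NormedSpace ℝ E] [MeasurableSpace E] [BorelSpace E] [SecondCountableTopology E]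
    (A : Finset ι) : MeasurableSet (islandEvent A : Set (ι → E)) := by
  simp only [islandEvent, Set.ofPred_forall]
  refine MeasurableSet.iInter fun j => MeasurableSet.iInter fun _ => ?_
  have h : Continuous fun x : ι → E => ((fun a : A => x a), x j) := by fun_prop
  have h2 := (isClosed_mem_convexHull_range.preimage h).measurableSet.compl
  convert h2 using 1
  ext x
  simp only [Set.mem_ofPred_eq, Set.mem_compl_iff, Set.mem_preimage]
  rw [Set.image_eq_range]
  rfl

/-- Given the points indexed by A, the others miss the hull independently, each with probability one
minus its measure. -/
theorem measure_islandEvent {ι E : Type*} [Fintype ι] [NormedAddCommGroup E]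
    [NormedSpace ℝ E] [MeasurableSpace E] [BorelSpace E] [SecondCountableTopology E]
    (μ : Measure E) [IsProbabilityMeasure μ] (A : Finset ι) :
    Measure.pi (fun _ : ι => μ) (islandEvent A) =
      ∫⁻ x, ENNReal.ofReal ((1 - μ.real (convexHull ℝ (Set.range x))) ^ (Fintype.card ι - A.card))
        ∂Measure.pi fun _ : A => μ := by
  classical
  have hp := (measurePreserving_piEquivPiSubtypeProd (fun _ : ι => μ) (· ∈ A)).symm
  rw [← hp.measure_preimage_equiv,
    Measure.prod_apply (hp.measurable (measurableSet_islandEvent A))]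
  refine Eq.trans (lintegral_congr (g := fun x => ENNReal.ofReal
    ((1 - μ.real (convexHull ℝ (Set.range x))) ^ (Fintype.card ι - A.card))) fun x => ?_)
    (by congr!)
  have hm : MeasurableSet (convexHull ℝ (Set.range x)) :=
    ((Set.finite_range x).isCompact_convexHull (𝕜 := ℝ)).isClosed.measurableSet
  have hset : Prod.mk x ⁻¹' ((MeasurableEquiv.piEquivPiSubtypeProd (fun _ : ι => E) (· ∈ A)).symm ⁻¹'
      islandEvent A) = Set.pi Set.univ fun _ : {j // j ∉ A} => (convexHull ℝ (Set.range x))ᶜ := by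
    ext y
    simp only [islandEvent, Set.mem_preimage, Set.mem_ofPred_eq, Set.mem_univ_pi, Set.mem_compl_iff,
      Subtype.forall]
    refine forall_congr' fun j => forall_congr' fun hj => ?_
    have h1 : ∀ z, (MeasurableEquiv.piEquivPiSubtypeProd (fun _ : ι => E) (· ∈ A)).symm z =
      fun i => if h : i ∈ A then z.1 ⟨i, h⟩ else z.2 ⟨i, h⟩ := fun z => rfl
    rw [h1, Set.image_eq_range]
    simp [hj]
  rw [hset, Measure.pi_pi, Finset.prod_const, Finset.card_univ, Fintype.card_subtype_compl,
    Fintype.card_coe, ENNReal.ofReal_pow (sub_nonneg.2 measureReal_le_one),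
    ← probReal_compl_eq_one_sub hm, ofReal_measureReal]

theorem ae_injective_pi_restrict {ι E : Type*} [Fintype ι] [NormedAddCommGroup E]
    [NormedSpace ℝ E] [FiniteDimensional ℝ E] [Nontrivial E] [MeasureSpace E] [BorelSpace E]
    [(volume : Measure E).IsAddHaarMeasure] (K : Set E) :
    ∀ᵐ x ∂Measure.pi (fun _ : ι => volume.restrict K), Function.Injective x := by
  classical
  rw [← Measure.restrict_pi_pi]
  refine ae_restrict_of_ae ?_
  have h : ∀ i j : ι, i ≠ j → ∀ᵐ x ∂(volume : Measure (ι → E)), x i ≠ x j := by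
    intro i j hij
    rw [ae_iff]
    obtain ⟨v, hv⟩ := exists_ne (0 : E)
    -- Coincidence of two points is a proper linear subspace of the configuration space; `Pi.single
    -- i v` lies outside it.
    refine measure_mono_null ?_ (Measure.addHaar_submodule (volume : Measure (ι → E))
      (LinearMap.ker (LinearMap.proj (R := ℝ) (φ := fun _ : ι => E) i - LinearMap.proj j))
      fun htop => ?_)
    · intro x hx
      simpa [sub_eq_zero] using hx
    · have : (Pi.single i v : ι → E) ∈ LinearMap.ker
        (LinearMap.proj (R := ℝ) (φ := fun _ : ι => E) i - LinearMap.proj j) := htop ▸ trivial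
      simp [hij.symm, hv] at this
  have h2 : ∀ᵐ x ∂(volume : Measure (ι → E)), ∀ i j : ι, i ≠ j → x i ≠ x j := by
    rw [ae_all_iff]; intro i
    rw [ae_all_iff]; intro j
    by_cases hij : i = j
    · simp [hij]
    · filter_upwards [h i j hij] with x hx _ using hx
  filter_upwards [h2] with x hx i j hxij
  by_contra hij
  exact hx i j hij hxij

theorem measure_islandEvent_le {d k : ℕ} (hd : 1 ≤ d) (hk : d + 1 ≤ k) {ι : Type*} [Fintype ι]
    (hkn : k ≤ Fintype.card ι) {K : Set (EuclideanSpace ℝ (Fin d))} (hKm : MeasurableSet K)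
    (hKc : Convex ℝ K) (hK : volume K = 1) {A : Finset ι} (hA : A.card = k) :
    (Measure.pi fun _ : ι => volume.restrict K).real (islandEvent A) ≤
      k.factorial / d.factorial * (2 ^ (d - 1) * d.factorial) ^ (k - d) *
        ((k - d).factorial * (Fintype.card ι - k).factorial / (Fintype.card ι - d).factorial) := by
  have hprob : IsProbabilityMeasure (volume.restrict K) := ⟨by simpa using hK⟩
  rw [measureReal_def, measure_islandEvent, hA]
  have hm : Measurable fun x : A → EuclideanSpace ℝ (Fin d) =>
      (volume.restrict K).real (convexHull ℝ (Set.range x)) :=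
    (measurable_measure_prodMk_left isClosed_mem_convexHull_range.measurableSet).ennreal_toReal
  refine ENNReal.toReal_le_of_le_ofReal (by positivity) ?_
  have h := lintegral_one_sub_pow_le (Measure.pi fun _ : A => volume.restrict K) hm
    (fun x => measureReal_nonneg) (fun x => measureReal_le_one)
    (C := k.factorial / d.factorial * (2 ^ (d - 1) * d.factorial) ^ (k - d)) (q := k - d)
    (by positivity) (fun t ht => ?_) (Fintype.card ι - k)
  · rwa [show Fintype.card ι - k + (k - d) = Fintype.card ι - d by omega] at h
  · have := measure_convexHull_le hd hk (ι := A) (by simpa using hA) hKm hKc hK ht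
    rwa [mul_pow _ t, ← mul_assoc] at this

/-! ### Comparison with the stated bound -/

/-- The k-1-d factors n-d, …, n-k+2 that are missing on the left all exceed n-k+1. -/
theorem descFactorial_le_div {d k n : ℕ} (hk : d + 1 ≤ k) (hkn : k ≤ n) :
    (n.descFactorial d : ℝ) ≤
      (n.descFactorial (k - 1) : ℝ) / ((n : ℝ) - k + 1) ^ (k - d - 1) := by
  have hpos : (0 : ℝ) < (n : ℝ) - k + 1 := by
    have : (k : ℝ) ≤ n := by exact_mod_cast hkn
    linarith
  rw [le_div_iff₀ (by positivity)]
  have h1 := Nat.descFactorial_mul_descFactorial (k := d) (m := k - 1) (n := n) (by omega)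
  have h2 := Nat.pow_sub_le_descFactorial (n - d) (k - 1 - d)
  have h3 : (n - k + 1) ^ (k - d - 1) ≤ (n - d).descFactorial (k - 1 - d) := by
    rw [show k - d - 1 = k - 1 - d by omega]
    exact (Nat.pow_le_pow_left (by omega) _).trans h2
  have h4 : (((n - k + 1 : ℕ) : ℝ)) = (n : ℝ) - k + 1 := by
    push_cast [Nat.cast_sub hkn]; ring
  rw [← h4, ← h1, mul_comm]
  exact_mod_cast Nat.mul_le_mul_right _ h3

theorem pow_mul_factorial_le {d : ℕ} (hd : 2 ≤ d) :
    2 ^ (d - 1) * d.factorial ≤ 2 * d ^ (2 * d - 1) := by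
  obtain ⟨m, rfl⟩ : ∃ m, d = m + 2 := ⟨d - 2, by omega⟩
  calc 2 ^ (m + 2 - 1) * (m + 2).factorial ≤ 2 * (m + 2) ^ m * (m + 2) ^ (m + 2) := by
        refine Nat.mul_le_mul ?_ (Nat.factorial_le_pow _)
        rw [show m + 2 - 1 = m + 1 by omega, pow_succ, mul_comm]
        exact Nat.mul_le_mul_left _ (Nat.pow_le_pow_left (by omega) _)
    _ = 2 * (m + 2) ^ (2 * m + 2) := by rw [mul_assoc, ← pow_add]; congr 2; ring
    _ ≤ 2 * (m + 2) ^ (2 * (m + 2) - 1) :=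
        Nat.mul_le_mul_left _ (Nat.pow_le_pow_right (by omega) (by omega))

theorem le_choose_of_pos_of_lt {m j : ℕ} (hj : 1 ≤ j) (hjm : j < m) : m ≤ m.choose j := by
  induction m with
  | zero => omega
  | succ m ih =>
    obtain ⟨i, rfl⟩ : ∃ i, j = i + 1 := ⟨j - 1, by omega⟩
    rcases eq_or_lt_of_le (Nat.le_of_lt_succ hjm) with h | h
    · rw [h, Nat.choose_succ_self_right]
    · have h1 := Nat.choose_pos (show i ≤ m by omega)
      have h2 := ih h
      rw [Nat.choose_succ_succ']
      omega

/-- With r = k-d-1, r! ≤ r^r ≤ k^r, and k ≤ C(k, ⌊d/2⌋) because 1 ≤ ⌊d/2⌋ < k. -/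
theorem factorial_mul_pow_le {d k : ℕ} (hd : 2 ≤ d) (hk : d + 1 ≤ k) :
    (k - d - 1).factorial * (2 ^ (d - 1) * d.factorial) ^ (k - d - 1) ≤
      (2 * d ^ (2 * d - 1) * k.choose (d / 2)) ^ (k - d - 1) := by
  have h1 : k ≤ k.choose (d / 2) := le_choose_of_pos_of_lt (by omega) (by omega)
  rw [mul_comm, mul_pow _ (k.choose _)]
  refine Nat.mul_le_mul (Nat.pow_le_pow_left (pow_mul_factorial_le hd) _) ?_
  exact (Nat.factorial_le_pow _).trans (Nat.pow_le_pow_left (by omega) _)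

theorem choose_mul_le_islandBound {d k n : ℕ} (hd : 2 ≤ d) (hk : d + 1 ≤ k) (hkn : k ≤ n) :
    (n.choose k : ℝ) * (k.factorial / d.factorial * (2 ^ (d - 1) * d.factorial) ^ (k - d) *
        ((k - d).factorial * (n - k).factorial / (n - d).factorial)) ≤ islandBound d k n := by
  have e1 : (n.choose k : ℝ) * k.factorial * (n - k).factorial = n.factorial := by
    exact_mod_cast Nat.choose_mul_factorial_mul_factorial hkn
  have e2 : ((n - d).factorial : ℝ) * n.descFactorial d = n.factorial := by
    exact_mod_cast Nat.factorial_mul_descFactorial (show d ≤ n by omega)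
  obtain ⟨r, rfl⟩ := Nat.exists_eq_add_of_le hk
  have e3 : d + 1 + r - d = r + 1 := by omega
  have hd0 : (d.factorial : ℝ) ≠ 0 := by exact_mod_cast d.factorial_ne_zero
  have hnd0 : ((n - d).factorial : ℝ) ≠ 0 := by exact_mod_cast (n - d).factorial_ne_zero
  calc _ = ((n.choose (d + 1 + r) : ℝ) * (d + 1 + r).factorial * (n - (d + 1 + r)).factorial) *
        ((2 ^ (d - 1) * d.factorial) ^ (d + 1 + r - d) *
        (d + 1 + r - d).factorial / (d.factorial * (n - d).factorial)) := by field_simp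
    -- Up to here equality holds: the estimate obtained is already a constant times n(n-1)⋯(n-d+1).
    -- Only the next step loses.
    _ = 2 ^ (d - 1) * (r.factorial * (2 ^ (d - 1) * d.factorial) ^ r) * (r + 1) *
        n.descFactorial d := by
        rw [e1, ← e2, e3, pow_succ, Nat.factorial_succ]
        push_cast
        field_simp
    _ ≤ islandBound d (d + 1 + r) n := by
        have h1 := factorial_mul_pow_le hd hk
        rw [show d + 1 + r - d - 1 = r by omega] at h1
        have h1' : ((r.factorial : ℝ) * (2 ^ (d - 1) * d.factorial) ^ r) ≤
          (2 * (d : ℝ) ^ (2 * d - 1) * ((d + 1 + r).choose (d / 2) : ℝ)) ^ r := by exact_mod_cast h1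
        have h2 := descFactorial_le_div hk hkn
        rw [islandBound]
        rw [show d + 1 + r - d - 1 = r by omega] at h2 ⊢
        rw [show ((d + 1 + r : ℕ) : ℝ) - d = r + 1 by push_cast; ring]
        gcongr

theorem islandBound_le {d k n : ℕ} (hk : d + 1 ≤ k) (hkn : k ≤ n) :
    islandBound d k n ≤ 2 ^ (d - 1) *
      (2 * (d : ℝ) ^ (2 * d - 1) * (k.choose (d / 2) : ℝ)) ^ (k - d - 1) * ((k : ℝ) - d) *
        k ^ (k - d - 1) * (n : ℝ) ^ d := by
  have hkn' : (k : ℝ) ≤ n := by exact_mod_cast hkn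
  have hk1 : (1 : ℝ) ≤ k := by exact_mod_cast (show 1 ≤ k by omega)
  have hdk : (d : ℝ) ≤ k := by exact_mod_cast (show d ≤ k by omega)
  have hpos : (0 : ℝ) < (n : ℝ) - k + 1 := by linarith
  rw [islandBound, mul_assoc _ ((k : ℝ) ^ _)]
  refine mul_le_mul_of_nonneg_left ?_ (mul_nonneg (by positivity) (sub_nonneg.2 hdk))
  rw [div_le_iff₀ (by positivity)]
  calc (n.descFactorial (k - 1) : ℝ) ≤ (n : ℝ) ^ (k - 1) := by
        exact_mod_cast Nat.descFactorial_le_pow n (k - 1)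
    _ = (n : ℝ) ^ d * (n : ℝ) ^ (k - d - 1) := by rw [← pow_add]; congr 1; omega
    _ ≤ (n : ℝ) ^ d * (k * ((n : ℝ) - k + 1)) ^ (k - d - 1) := by
        gcongr
        -- n ≤ k(n-k+1), since the difference is (k-1)(n-k).
        nlinarith
    _ = _ := by rw [mul_pow]; ring

/-! ### The expected number of islands -/

theorem integrable_and_integral_numIslands_le {d k n : ℕ} (hd : 2 ≤ d) (hk : d + 1 ≤ k)
    (hkn : k ≤ n) {K : Set (EuclideanSpace ℝ (Fin d))} (hKm : MeasurableSet K)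
    (hKc : Convex ℝ K) (hK : volume K = 1) :
    Integrable (fun x : Fin n → EuclideanSpace ℝ (Fin d) => (numIslands k (Set.range x) : ℝ))
      (Measure.pi fun _ => volume.restrict K) ∧
    ∫ x : Fin n → EuclideanSpace ℝ (Fin d), (numIslands k (Set.range x) : ℝ)
      ∂(Measure.pi fun _ => volume.restrict K) ≤ islandBound d k n := by
  have hprob : IsProbabilityMeasure (volume.restrict K) := ⟨by simpa using hK⟩
  have : Nonempty (Fin d) := ⟨⟨0, by omega⟩⟩
  have hae : (fun x : Fin n → EuclideanSpace ℝ (Fin d) => (numIslands k (Set.range x) : ℝ))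
      =ᵐ[Measure.pi fun _ => volume.restrict K]
      fun x => ∑ A ∈ Finset.powersetCard k Finset.univ, (islandEvent A).indicator 1 x := by
    filter_upwards [ae_injective_pi_restrict K] with x hx using numIslands_range k hx
  have hint : ∀ A ∈ Finset.powersetCard k (Finset.univ : Finset (Fin n)),
      Integrable ((islandEvent A).indicator (1 : (Fin n → EuclideanSpace ℝ (Fin d)) → ℝ))
        (Measure.pi fun _ => volume.restrict K) := fun A _ =>
    (integrable_const (1 : ℝ)).indicator (measurableSet_islandEvent A)
  refine ⟨(integrable_congr hae).2 (integrable_finsetSum _ hint), ?_⟩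
  rw [integral_congr_ae hae, integral_finsetSum _ hint]
  refine le_trans ?_ (choose_mul_le_islandBound hd hk hkn)
  calc _ ≤ ∑ A ∈ Finset.powersetCard k (Finset.univ : Finset (Fin n)),
        (k.factorial / d.factorial * (2 ^ (d - 1) * d.factorial) ^ (k - d) *
        ((k - d).factorial * (n - k).factorial / (n - d).factorial) : ℝ) := by
        refine Finset.sum_le_sum fun A hA => ?_
        rw [integral_indicator_one (measurableSet_islandEvent A)]
        simpa using measure_islandEvent_le (show 1 ≤ d by omega) hk (by simpa using hkn)
          hKm hKc hK (Finset.mem_powersetCard.1 hA).2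
    _ = _ := by simp

theorem IsUniformSample.map_eq {d n : ℕ} {K : Set (EuclideanSpace ℝ (Fin d))}
    (hK : volume K = 1) {Ω : Type*} [MeasurableSpace Ω] {P : Measure Ω} [IsProbabilityMeasure P]
    {X : Fin n → Ω → EuclideanSpace ℝ (Fin d)} (hX : IsUniformSample K P X) :
    AEMeasurable (fun ω i => X i ω) P ∧
      P.map (fun ω i => X i ω) = Measure.pi fun _ => volume.restrict K := by
  have hm : ∀ i, AEMeasurable (X i) P := fun i =>
    pdf.IsUniform.aemeasurable (by simp [hK]) (by simp [hK]) (hX.1 i)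
  refine ⟨aemeasurable_pi_lambda _ hm, ?_⟩
  rw [(iIndepFun_iff_map_fun_eq_pi_map hm).1 hX.2]
  congr 1
  ext1 i
  rw [show P.map (X i) = _ from hX.1 i, ProbabilityTheory.cond, hK]
  simp

theorem IsUniformSample.integrable_and_integral_numIslands_le {d k n : ℕ} (hd : 2 ≤ d)
    (hk : d + 1 ≤ k) (hkn : k ≤ n) {K : Set (EuclideanSpace ℝ (Fin d))} (hKb : IsConvexBody K)
    (hK : volume K = 1) {Ω : Type*} [MeasurableSpace Ω] {P : Measure Ω} [IsProbabilityMeasure P]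
    {X : Fin n → Ω → EuclideanSpace ℝ (Fin d)} (hX : IsUniformSample K P X) :
    Integrable (fun ω => (numIslands k (Set.range fun i => X i ω) : ℝ)) P ∧
      ∫ ω, (numIslands k (Set.range fun i => X i ω) : ℝ) ∂P ≤ islandBound d k n := by
  obtain ⟨hm, hmap⟩ := hX.map_eq hK
  obtain ⟨h1, h2⟩ := _root_.integrable_and_integral_numIslands_le hd hk hkn
    hKb.1.isClosed.measurableSet hKb.2.1 hK
  rw [← hmap] at h1 h2
  rw [integral_map hm h1.aestronglyMeasurable] at h2
  exact ⟨h1.comp_aemeasurable hm, h2⟩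

theorem theorem1 (d k : ℕ) (hd : 2 ≤ d) (hk : d + 1 ≤ k) :
    (∀ n : ℕ, k ≤ n → ∀ K : Set (EuclideanSpace ℝ (Fin d)), IsConvexBody K → volume K = 1 →
      ∀ (Ω : Type*) [MeasurableSpace Ω] (P : Measure Ω) [IsProbabilityMeasure P]
        (X : Fin n → Ω → EuclideanSpace ℝ (Fin d)), IsUniformSample K P X →
        Integrable (fun ω => (numIslands k (Set.range fun i => X i ω) : ℝ)) P ∧
        ∫ ω, (numIslands k (Set.range fun i => X i ω) : ℝ) ∂P ≤ islandBound d k n) ∧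
    (fun n : ℕ => islandBound d k n) =O[atTop] (fun n : ℕ => (n : ℝ) ^ d) ∧
    (∃ C : ℝ, ∀ n : ℕ, k ≤ n →
      ∀ K : Set (EuclideanSpace ℝ (Fin d)), IsConvexBody K → volume K = 1 →
      ∀ (Ω : Type*) [MeasurableSpace Ω] (P : Measure Ω) [IsProbabilityMeasure P]
        (X : Fin n → Ω → EuclideanSpace ℝ (Fin d)), IsUniformSample K P X →
        ∫ ω, (numIslands k (Set.range fun i => X i ω) : ℝ) ∂P ≤ C * (n : ℝ) ^ d) := by
  refine ⟨fun n hn K hKb hK Ω _ P _ X hX =>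
      hX.integrable_and_integral_numIslands_le hd hk hn hKb hK,
    IsBigO.of_bound (2 ^ (d - 1) *
      (2 * (d : ℝ) ^ (2 * d - 1) * (k.choose (d / 2) : ℝ)) ^ (k - d - 1) * ((k : ℝ) - d) *
        k ^ (k - d - 1)) ?_, _, fun n hn K hKb hK Ω _ P _ X hX =>
      (hX.integrable_and_integral_numIslands_le hd hk hn hKb hK).2.trans (islandBound_le hk hn)⟩
  · filter_upwards [eventually_ge_atTop k] with n hn
    have hkn' : (k : ℝ) ≤ n := by exact_mod_cast hn
    have hdk : (d : ℝ) ≤ k := by exact_mod_cast (show d ≤ k by omega)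
    have h0 : 0 ≤ islandBound d k n := by
      have h1 : (0 : ℝ) ≤ k - d := by linarith
      have h2 : (0 : ℝ) ≤ n - k + 1 := by linarith
      rw [islandBound]
      positivity
    rw [Real.norm_of_nonneg h0, Real.norm_of_nonneg (by positivity)]
    exact islandBound_le hk hn
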